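/- Setting. Fix an action set $\mathcal A\subseteq\mathbb R^d$ with infinitely many elements and $\|a\|_2\le 1$ for all $a\in\mathcal A$. In the stochastic $d$-dimensional linear bandit problem with horizon $T$ there is a parameter $\theta^\star\in\mathbb R^d$ with $\|\theta^\star\|_2\le 1$, unknown to the player. In each round $t=1,\dots,T$ the player pulls an arm $a_t\in\mathcal A$ and receives the reward $r_t=\langle\theta^\star,a_t\rangle+\eta_t$, where $\eta_t$ is independent zero-mean $1$-subgaussian noise, i.e. $\mathbf E[e^{\lambda\eta_t}]\le e^{\lambda^2/2}$ for all $\lambda\in\mathbb R$ (the law of the noise is unknown and may depend on the round and on the arm pulled). A policy may use internal randomness $\xi$: it chooses $a_t$ as a function of $\xi$ and of $(a_1,r_1),\dots,(a_{t-1},r_{t-1})$. It is $\rho$-reproducible if, for every such environment, two executions with the same $\xi$ and independent rewards pull exactly the same sequence of $T$ arms with probability at least $1-\rho$. Its expected regret is $$\mathbf E[R_T]=T\sup_{a\in\mathcal A}\langle\theta^\star,a\rangle-\mathbf E\Big[\sum_{t=1}^T\langle\theta^\star,a_t\rangle\Big].$$ Corollary. There is an absolute constant $C>0$ such that for all $d$,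 all integers $T\ge 2$, all $\rho\in(0,1]$ and every action set $\mathcal A$ as above, there are a finite $T^{-1/(4d+2)}$-net $\mathcal A'\subseteq\mathcal A$ of $\mathcal A$ (every $a\in\mathcal A$ has some $a'\in\mathcal A'$ with $\|a-a'\|_2\le T^{-1/(4d+2)}$) and a $\rho$-reproducible policy, depending only on $d,T,\rho,\mathcal A$ and pulling only arms of $\mathcal A'$, whose expected regret in every such environment satisfies $$\mathbf E[R_T]\le C\cdot\frac{T^{\frac{4d+1}{4d+2}}}{\rho^2}\sqrt{d\log T}.$$ -/

import Mathlib

open MeasureTheory ProbabilityTheory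
open scoped RealInnerProductSpace

/-- A bandit algorithm with set of arms `α`. It has some internal randomness `ξ`, drawn once from
the probability distribution `seedLaw`, and in round `t` (rounds are numbered from `0`) it chooses
an arm as a measurable function of `ξ` and of the `t` arm-reward pairs seen so far. -/
structure BanditPolicy (α : Type) [MeasurableSpace α] where
  Seed : Type
  [seedSpace : MeasurableSpace Seed]
  seedLaw : Measure Seed
  [seedProb : IsProbabilityMeasure seedLaw]
  act : (t : ℕ) → Seed → (Fin t → α × ℝ) → α
  measurable_act : ∀ t : ℕ, Measurable fun p : Seed × (Fin t → α × ℝ) => act t p.1 p.2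

attribute [instance] BanditPolicy.seedSpace BanditPolicy.seedProb

namespace BanditPolicy

variable {α : Type} [MeasurableSpace α]

/-- The first `t` arm-reward pairs of the execution with internal randomness `ξ`, when `x (s, a)` is
the reward that arm `a` yields if it is pulled in round `s`. -/
def history (π : BanditPolicy α) (ξ : π.Seed) (x : ℕ × α → ℝ) : (t : ℕ) → Fin t → α × ℝ
  | 0 => Fin.elim0
  | t + 1 =>
      let h := history π ξ x t
      let a := π.act t ξ h
      Fin.snoc (α := fun _ => α × ℝ) h (a, x (t, a))

/-- The arm pulled in round `t`. -/
def action (π : BanditPolicy α) (ξ : π.Seed) (x : ℕ × α → ℝ) (t : ℕ) : α :=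
  π.act t ξ (π.history ξ x t)

end BanditPolicy

/-- The joint law of all potential rewards: independent over rounds and arms, the reward of arm `a`
in round `t` having law `D t a`. -/
noncomputable def rewardLaw {α : Type} (D : ℕ → α → Measure ℝ)
    [∀ t a, IsProbabilityMeasure (D t a)] : Measure (ℕ × α → ℝ) :=
  Measure.infinitePi fun p : ℕ × α => D p.1 p.2

/-- `π` is `ρ`-reproducible over `T` rounds on a class `𝓔` of stochastic environments: for every
environment in the class, two executions with the same internal randomness and with independent
rewards pull exactly the same sequence of arms with probability at least `1 - ρ`. -/
def BanditPolicy.IsReproducible {α : Type} [MeasurableSpace α] (π : BanditPolicy α) (T : ℕ) (ρ : ℝ)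
    (𝓔 : (ℕ → α → Measure ℝ) → Prop) : Prop :=
  ∀ (D : ℕ → α → Measure ℝ) [∀ t a, IsProbabilityMeasure (D t a)], 𝓔 D →
    1 - ρ ≤ (π.seedLaw.prod ((rewardLaw D).prod (rewardLaw D))).real
      {p | ∀ t < T, π.action p.1 p.2.1 t = π.action p.1 p.2.2 t}

/-- The rewards `D` form a stochastic linear environment with parameter `θ` on the arms `N`: pulling
`a` gives `⟪θ, a⟫` plus noise `η` with `E η = 0` and `E exp (l η) ≤ exp (l ^ 2 / 2)` for all real
`l`. The law of the noise may depend on the round and on the arm. -/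
def IsLinearEnvironment {d : ℕ} (N : Finset (EuclideanSpace ℝ (Fin d)))
    (θ : EuclideanSpace ℝ (Fin d)) (D : ℕ → N → Measure ℝ) : Prop :=
  ∀ (t : ℕ) (a : N),
    IsProbabilityMeasure (D t a) ∧
    ∫ r, r ∂(D t a) = ⟪θ, (a : EuclideanSpace ℝ (Fin d))⟫ ∧
    HasSubgaussianMGF (fun r : ℝ => r - ⟪θ, (a : EuclideanSpace ℝ (Fin d))⟫) 1 (D t a)

/-- The expected regret, with respect to the whole action set `A`, of `T` rounds of a policy that
plays arms of `N`. -/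
noncomputable def linearExpectedRegret {d : ℕ} (A : Set (EuclideanSpace ℝ (Fin d)))
    (θ : EuclideanSpace ℝ (Fin d)) (T : ℕ) {N : Finset (EuclideanSpace ℝ (Fin d))}
    (π : BanditPolicy N) (D : ℕ → N → Measure ℝ) [∀ t a, IsProbabilityMeasure (D t a)] : ℝ :=
  T * (⨆ a : A, ⟪θ, (a : EuclideanSpace ℝ (Fin d))⟫) -
    ∫ p, ∑ t ∈ Finset.range T, ⟪θ, (π.action p.1 p.2 t : EuclideanSpace ℝ (Fin d))⟫
      ∂(π.seedLaw.prod (rewardLaw D))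

/-! Explore then commit, on a finite net `N` of `A`. A barycentric spanner of `N` consists of `m ≤
d` arms, and errors in their estimated rewards spread to any arm of `N` with coefficients in `[-1,
1]` (`exists_greedy`). So `n` pulls of each spanner arm suffice, whatever the size of `N`.
Reproducibility comes from rounding the `m` sample means to a grid of width `w` with a shared random
shift. The two executions round a mean differently with probability at most its expected discrepancy
divided by `w`, hence at most `4 / (√n * w)` (`measure_roundedMean_ne_le`). With `w = 4 * d / (ρ *
√n)`, a union bound over the spanner gives `ρ`. With `x = T ^ (1 / (4 * d + 2))` and `n ≈ x ^ (4 *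
d)`, the regret is at most the sum of `T / x` for the net, `2 * m * n` for exploration and `2 * T *
m * (w + 2 / √n)` for committing to a greedy arm. `regret_rate_le` compares this sum, together with
the trivial bound `2 * T`, to the claimed rate. -/

/-! ### Barycentric spanners. -/

/-- Every finite subset of a finite-dimensional real vector space has a barycentric spanner: at most
`finrank` of its elements such that all its elements are combinations of these with coefficients in
`[-1, 1]`. -/
lemma exists_barycentric_spanner {E : Type*} [AddCommGroup E] [Module ℝ E] [FiniteDimensional ℝ E]
    (N : Finset E) :
    ∃ (m : ℕ) (b : Fin m → N) (c : N → Fin m → ℝ), m ≤ Module.finrank ℝ E ∧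
      (∀ a i, |c a i| ≤ 1) ∧ ∀ a : N, (a : E) = ∑ i, c a i • (b i : E) := by
  classical
  let V := Submodule.span ℝ (N : Set E)
  let e := Module.finBasis ℝ V
  let ι : N → V := fun a => ⟨a, Submodule.subset_span a.2⟩
  obtain ⟨f, hfN, -, hf⟩ := Submodule.exists_fun_fin_finrank_span_eq ℝ (N : Set E)
  let f' : Fin (Module.finrank ℝ V) → N := fun i => ⟨f i, hfN i⟩
  have hf' : LinearIndependent ℝ (ι ∘ f') := LinearIndependent.of_comp V.subtype hf
  have hdet' : e.det (ι ∘ f') ≠ 0 :=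
    (e.is_basis_iff_det.1 ⟨hf', hf'.span_eq_top_of_card_eq_finrank' (by simp)⟩).ne_zero
  have : Nonempty (Fin (Module.finrank ℝ V) → N) := ⟨f'⟩
  -- A tuple of maximal `|det|` works: by Cramer's rule the `i`-th coordinate of `a` is the ratio of
  -- the determinant with `b i` replaced by `a` to the original one.
  obtain ⟨b, hb⟩ := Finite.exists_max fun b : Fin (Module.finrank ℝ V) → N => |e.det (ι ∘ b)|
  have hpos : 0 < |e.det (ι ∘ b)| := (abs_pos.2 hdet').trans_le (hb f')
  have hne : e.det (ι ∘ b) ≠ 0 := abs_pos.1 hpos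
  obtain ⟨hli, hsp⟩ := e.is_basis_iff_det.2 (isUnit_iff_ne_zero.2 hne)
  let B := Module.Basis.mk hli hsp.ge
  refine ⟨_, b, fun a i => B.coord i (ι a), Submodule.finrank_le V, fun a i => ?_, fun a => ?_⟩
  · have h := LinearMap.congr_fun (e.det_smul_mk_coord_eq_det_update hli hsp.ge i) (ι a)
    have h' : e.det (ι ∘ b) * B.coord i (ι a) = e.det (ι ∘ Function.update b i a) := by
      rw [Function.comp_update]
      exact h
    have := hb (Function.update b i a)
    simp only [← h', abs_mul] at this
    exact le_of_mul_le_mul_left (by simpa using this) hpos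
  · have h := congrArg V.subtype (B.sum_repr (ι a))
    simp only [map_sum, map_smul] at h
    rw [show (a : E) = V.subtype (ι a) from rfl, ← h]
    refine Finset.sum_congr rfl fun i _ => ?_
    simp [B, ι]

/-! ### Mean absolute deviation of subgaussian averages. -/

/-- Pointwise `|X| ≤ cosh X`, and the mean of `cosh X` is at most `exp (1 / 2) ≤ 2`. -/
lemma integral_abs_le_two_of_hasSubgaussianMGF {Ω : Type*} [MeasurableSpace Ω] {P : Measure Ω}
    {X : Ω → ℝ} (h : HasSubgaussianMGF X 1 P) : ∫ ω, |X ω| ∂P ≤ 2 := by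
  have hexp : Real.exp (1 / 2) ≤ 2 := by
    have h1 : Real.exp (1 / 2) * Real.exp (1 / 2) = Real.exp 1 := by
      rw [← Real.exp_add]; norm_num
    nlinarith [Real.exp_one_lt_d9, Real.exp_pos (1 / 2)]
  have h1 := h.mgf_le 1
  have h2 := h.mgf_le (-1)
  norm_num [mgf] at h1 h2 hexp
  calc ∫ ω, |X ω| ∂P ≤ ∫ ω, (Real.exp (1 * X ω) + Real.exp (-1 * X ω)) / 2 ∂P := by
        refine integral_mono h.integrable.abs
          (((h.integrable_exp_mul 1).add (h.integrable_exp_mul (-1))).div_const 2) fun ω => ?_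
        have h3 := Real.quadratic_le_exp_of_nonneg (abs_nonneg (X ω))
        have h4 := Real.add_one_le_exp (-|X ω|)
        have h5 : Real.exp |X ω| + Real.exp (-|X ω|) = Real.exp (X ω) + Real.exp (-X ω) := by
          rcases abs_cases (X ω) with ⟨h, -⟩ | ⟨h, -⟩ <;> rw [h]
          rw [neg_neg, add_comm]
        simp only [one_mul, neg_mul]
        nlinarith [sq_nonneg (|X ω| - 2)]
    _ ≤ 2 := by
        rw [integral_div, integral_add (h.integrable_exp_mul 1) (h.integrable_exp_mul (-1))]
        norm_num
        linarith

/-- Dividing the sum by `√n` makes it 1-subgaussian again, so the previous bound applies to it. -/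
lemma integral_abs_sum_div_le {Ω : Type*} [MeasurableSpace Ω] {P : Measure Ω}
    {X : ℕ → Ω → ℝ} (hX : iIndepFun X P) (h : ∀ j, HasSubgaussianMGF (X j) 1 P) {n : ℕ}
    (hn : 0 < n) : ∫ ω, |(∑ j ∈ Finset.range n, X j ω) / n| ∂P ≤ 2 / √n := by
  have hs : (0 : ℝ) < √n := Real.sqrt_pos.2 (by exact_mod_cast hn)
  have h1 : HasSubgaussianMGF (fun ω => 1 / √n * ∑ j ∈ Finset.range n, X j ω) 1 P := by
    have hc : ∀ c : NNReal, (c : ℝ) = (1 / √n) ^ 2 → c * ∑ _j ∈ Finset.range n, 1 = 1 := by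
      intro c hc
      ext
      have : (n : ℝ) ≠ 0 := by positivity
      simp [hc, this]
    have h0 (c : NNReal) (hc' : c = ⟨(1 / √n) ^ 2, sq_nonneg _⟩) :
        HasSubgaussianMGF (fun ω => 1 / √n * ∑ j ∈ Finset.range n, X j ω)
          (c * ∑ _j ∈ Finset.range n, 1) P :=
      hc' ▸ (HasSubgaussianMGF.sum_of_iIndepFun hX fun j _ => h j).const_mul (1 / √n)
    rw [← hc ⟨(1 / √n) ^ 2, sq_nonneg _⟩ rfl]
    exact h0 _ rfl
  have h2 := integral_abs_le_two_of_hasSubgaussianMGF h1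
  calc ∫ ω, |(∑ j ∈ Finset.range n, X j ω) / n| ∂P
      = ∫ ω, |1 / √n * ∑ j ∈ Finset.range n, X j ω| / √n ∂P := by
        refine integral_congr_ae (ae_of_all _ fun ω => ?_)
        simp only
        rw [← abs_of_pos hs, ← abs_div, abs_of_pos hs]
        congr 1
        conv_lhs => rw [← Real.mul_self_sqrt (Nat.cast_nonneg (α := ℝ) n)]
        field_simp
    _ ≤ 2 / √n := by rw [integral_div]; gcongr

/-! ### Rounding with a random shift. -/

lemma intervalIntegrable_floor_add (u : ℝ) :
    IntervalIntegrable (fun x : ℝ => (⌊u + x⌋ : ℝ)) volume 0 1 :=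
  Monotone.intervalIntegrable fun x y h => by
    exact_mod_cast Int.floor_mono (add_le_add_right h u)

/-- By periodicity the integral of `Int.fract (u + x)` does not depend on `u`; the case `u = 0`,
where the floor vanishes almost everywhere, fixes its value. -/
lemma integral_floor_add (u : ℝ) : ∫ x in (0 : ℝ)..1, (⌊u + x⌋ : ℝ) = u := by
  have h1 : ∀ v : ℝ, ∫ x in (0 : ℝ)..1, (⌊v + x⌋ : ℝ) =
      v + 1 / 2 - ∫ x in (0 : ℝ)..1, Int.fract (v + x) := by
    intro v
    have : ∀ x, Int.fract (v + x) = (v + x) - (⌊v + x⌋ : ℝ) := fun x => rfl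
    simp_rw [this]
    rw [intervalIntegral.integral_sub (Continuous.intervalIntegrable (by fun_prop) _ _)
      (intervalIntegrable_floor_add v), intervalIntegral.integral_add (by simp) (by simp)]
    simp
  have h2 : ∫ x in (0 : ℝ)..1, Int.fract (u + x) = ∫ x in (0 : ℝ)..1, Int.fract (0 + x) := by
    have hp : Function.Periodic (Int.fract : ℝ → ℝ) 1 := fun x => Int.fract_add_one x
    have := hp.intervalIntegral_add_eq u 0
    simpa [intervalIntegral.integral_comp_add_left (fun x => Int.fract x)] using this
  have h3 : ∫ x in (0 : ℝ)..1, (⌊(0 : ℝ) + x⌋ : ℝ) = 0 := by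
    rw [intervalIntegral.integral_congr_ae (g := fun _ => 0)]
    · simp
    · have : ∀ᵐ x : ℝ, x ≠ 1 := by simp [ae_iff]
      filter_upwards [this] with x hx hx'
      rw [Set.uIoc_of_le zero_le_one] at hx'
      have : ⌊x⌋ = 0 := Int.floor_eq_zero_iff.2 ⟨hx'.1.le, lt_of_le_of_ne hx'.2 hx⟩
      simp [this]
  have h4 := h1 u
  have h5 := h1 0
  linarith

/-- The uniform distribution on `[0, 1]`. -/
noncomputable def uniformUnit : Measure ℝ := volume.restrict (Set.Ioc 0 1)

instance : IsProbabilityMeasure uniformUnit := ⟨by simp [uniformUnit]⟩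

/-- For `u ≤ v` the difference of the floors is a nonnegative integer, so it dominates the indicator
of being nonzero, and its mean is `v - u`. -/
lemma uniformUnit_floor_ne_le (u v : ℝ) :
    uniformUnit {x | ⌊u + x⌋ ≠ ⌊v + x⌋} ≤ ENNReal.ofReal |u - v| := by
  wlog h : u ≤ v generalizing u v
  · rw [abs_sub_comm]
    simpa [ne_comm] using this v u (le_of_not_ge h)
  have hm : MeasurableSet {x : ℝ | ⌊u + x⌋ ≠ ⌊v + x⌋} :=
    (measurableSet_eq_fun (by fun_prop) (by fun_prop)).compl
  rw [← ofReal_measureReal]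
  refine ENNReal.ofReal_le_ofReal ?_
  have hint : ∀ w : ℝ, Integrable (fun x : ℝ => (⌊w + x⌋ : ℝ)) uniformUnit := fun w =>
    (intervalIntegrable_iff_integrableOn_Ioc_of_le zero_le_one).1 (intervalIntegrable_floor_add w)
  have hval : ∀ w : ℝ, ∫ x, (⌊w + x⌋ : ℝ) ∂uniformUnit = w := fun w => by
    rw [uniformUnit, ← intervalIntegral.integral_of_le zero_le_one, integral_floor_add]
  calc uniformUnit.real {x | ⌊u + x⌋ ≠ ⌊v + x⌋}
      = ∫ x, Set.indicator {x | ⌊u + x⌋ ≠ ⌊v + x⌋} 1 x ∂uniformUnit :=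
        (integral_indicator_one hm).symm
    _ ≤ ∫ x, ((⌊v + x⌋ : ℝ) - ⌊u + x⌋) ∂uniformUnit := by
        refine integral_mono ((integrable_const (1 : ℝ)).indicator hm)
          ((hint v).sub (hint u)) fun x => ?_
        have hle : ⌊u + x⌋ ≤ ⌊v + x⌋ := Int.floor_mono (by linarith)
        by_cases hx : ⌊u + x⌋ = ⌊v + x⌋
        · simp [hx]
        · have : ⌊u + x⌋ + 1 ≤ ⌊v + x⌋ := by omega
          have : (⌊u + x⌋ : ℝ) + 1 ≤ ⌊v + x⌋ := by exact_mod_cast this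
          simp only [Set.indicator, Set.mem_ofPred_eq, ne_eq, hx, not_false_eq_true, if_true,
            Pi.one_apply]
          linarith
    _ = |u - v| := by
        rw [integral_sub (hint v) (hint u), hval, hval, abs_of_nonpos (by linarith)]
        ring

lemma prod_uniformUnit_floor_ne_le {Ω : Type*} [MeasurableSpace Ω] {P : Measure Ω} [SFinite P]
    {X Y : Ω → ℝ} (hX : Measurable X) (hY : Measurable Y) :
    (uniformUnit.prod P) {p | ⌊X p.2 + p.1⌋ ≠ ⌊Y p.2 + p.1⌋} ≤
      ∫⁻ ω, ENNReal.ofReal |X ω - Y ω| ∂P := by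
  have hm : MeasurableSet {p : ℝ × Ω | ⌊X p.2 + p.1⌋ ≠ ⌊Y p.2 + p.1⌋} :=
    (measurableSet_eq_fun (by fun_prop) (by fun_prop)).compl
  rw [Measure.prod_apply_symm hm]
  exact lintegral_mono fun ω => uniformUnit_floor_ne_le (X ω) (Y ω)

lemma exists_finset_net {E : Type*} [NormedAddCommGroup E] [NormedSpace ℝ E]
    [FiniteDimensional ℝ E] {A : Set E} (hA : ∀ a ∈ A, ‖a‖ ≤ 1) {ε : ℝ} (hε : 0 < ε) :
    ∃ N : Finset E, (∀ a ∈ N, a ∈ A) ∧ ∀ a ∈ A, ∃ a' ∈ N, ‖a - a'‖ ≤ ε := by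
  have := FiniteDimensional.proper ℝ E
  have htb : TotallyBounded A := (isCompact_closedBall (0 : E) 1).totallyBounded.subset
    fun a ha => by simpa using hA a ha
  obtain ⟨t, htA, htf, ht⟩ := Metric.finite_approx_of_totallyBounded htb ε hε
  refine ⟨htf.toFinset, fun a ha => htA (by simpa using ha), fun a ha => ?_⟩
  obtain ⟨y, hy, hay⟩ := Set.mem_iUnion₂.1 (ht ha)
  exact ⟨y, by simpa using hy, by rw [← dist_eq_norm]; exact (Metric.mem_ball.1 hay).le⟩

/-! ### Accuracy and stability of the rounded sample means. -/

namespace BanditPolicy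

section Estimation

variable {α : Type}

/-- The mean of the `n` rewards that arm `b i` yields during round-robin exploration. -/
noncomputable def sampleMean {m : ℕ} (n : ℕ) (b : Fin m → α) (x : ℕ × α → ℝ) (i : Fin m) : ℝ :=
  (∑ j ∈ Finset.range n, x (j * m + i, b i)) / n

/-- The sample means, rounded to the grid of width `w` with offset `ξ`. -/
noncomputable def roundedMean {m : ℕ} (n : ℕ) (b : Fin m → α) (w : ℝ) (ξ : ℝ) (x : ℕ × α → ℝ)
    (i : Fin m) : ℤ :=
  ⌊sampleMean n b x i / w + ξ⌋

variable {m n : ℕ} {b : Fin m → α} {w : ℝ}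

lemma measurable_sampleMean (i : Fin m) : Measurable fun x => sampleMean n b x i := by
  unfold sampleMean
  fun_prop

lemma measurable_roundedMean :
    Measurable fun p : ℝ × (ℕ × α → ℝ) => roundedMean n b w p.1 p.2 :=
  measurable_pi_lambda _ fun i => Int.measurable_floor.comp
    ((((measurable_sampleMean i).comp measurable_snd).div_const w).add measurable_fst)

lemma measurableSet_roundedMean_eq :
    MeasurableSet {p : ℝ × (ℕ × α → ℝ) × (ℕ × α → ℝ) |
      roundedMean n b w p.1 p.2.1 = roundedMean n b w p.1 p.2.2} := by
  have h1 : Measurable fun p : ℝ × (ℕ × α → ℝ) × (ℕ × α → ℝ) => (p.1, p.2.1) := by fun_prop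
  have h2 : Measurable fun p : ℝ × (ℕ × α → ℝ) × (ℕ × α → ℝ) => (p.1, p.2.2) := by fun_prop
  have h3 : MeasurableSet {q : (Fin m → ℤ) × (Fin m → ℤ) | q.1 = q.2} := .of_discrete
  exact ((measurable_roundedMean.comp h1).prodMk (measurable_roundedMean.comp h2)) h3

/-- The shift need not be subtracted back: `⌊u + ξ⌋` is within `1` of `u` when `0 < ξ ≤ 1`. -/
lemma abs_mul_roundedMean_sub_le (hw : 0 < w) {ξ : ℝ} (hξ : ξ ∈ Set.Ioc (0 : ℝ) 1)
    (x : ℕ × α → ℝ) (i : Fin m) (y : ℝ) :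
    |w * roundedMean n b w ξ x i - y| ≤ w + |sampleMean n b x i - y| := by
  have h1 : |w * roundedMean n b w ξ x i - sampleMean n b x i| ≤ w := by
    have hz := Int.floor_le (sampleMean n b x i / w + ξ)
    have hz' := Int.lt_floor_add_one (sampleMean n b x i / w + ξ)
    have e : w * roundedMean n b w ξ x i - sampleMean n b x i =
        w * ((⌊sampleMean n b x i / w + ξ⌋ : ℝ) - sampleMean n b x i / w) := by
      rw [roundedMean]
      field_simp
    rw [e, abs_mul, abs_of_pos hw]
    refine mul_le_of_le_one_right hw.le (abs_le.2 ⟨?_, ?_⟩) <;> linarith [hξ.1, hξ.2]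
  have := abs_sub_le (w * roundedMean n b w ξ x i) (sampleMean n b x i) y
  linarith

variable {D : ℕ → α → Measure ℝ} [∀ t a, IsProbabilityMeasure (D t a)] {μ : α → ℝ}

instance : IsProbabilityMeasure (rewardLaw D) := by unfold rewardLaw; infer_instance

lemma hasSubgaussianMGF_reward
    (h : ∀ t a, HasSubgaussianMGF (fun r => r - μ a) 1 (D t a)) (p : ℕ × α) :
    HasSubgaussianMGF (fun x : ℕ × α → ℝ => x p - μ p.2) 1 (rewardLaw D) := by
  have he : (rewardLaw D).map (fun x => x p) = D p.1 p.2 :=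
    Measure.infinitePi_map_eval (μ := fun p : ℕ × α => D p.1 p.2) p
  refine HasSubgaussianMGF.of_map (X := fun r => r - μ p.2) (Y := fun x : ℕ × α → ℝ => x p)
    (measurable_pi_apply p).aemeasurable ?_
  rw [he]
  exact h p.1 p.2

lemma sampleMean_sub (hn : 0 < n) (x : ℕ × α → ℝ) (i : Fin m) :
    sampleMean n b x i - μ (b i) =
      (∑ j ∈ Finset.range n, (x (j * m + i, b i) - μ (b i))) / n := by
  have : (n : ℝ) ≠ 0 := by positivity
  rw [sampleMean, Finset.sum_sub_distrib]
  simp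
  field_simp

lemma integral_abs_sampleMean_sub_le
    (h : ∀ t a, HasSubgaussianMGF (fun r => r - μ a) 1 (D t a)) (hn : 0 < n) (i : Fin m) :
    ∫ x, |sampleMean n b x i - μ (b i)| ∂(rewardLaw D) ≤ 2 / √n := by
  have hind : iIndepFun (fun (p : ℕ × α) (x : ℕ × α → ℝ) => x p - μ p.2) (rewardLaw D) :=
    iIndepFun_infinitePi (P := fun p : ℕ × α => D p.1 p.2) (X := fun p r => r - μ p.2)
      fun p => by fun_prop
  -- The pulls of one arm occur in distinct rounds, so their rewards are distinct independent
  -- coordinates.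
  have hinj : Function.Injective fun j : ℕ => (j * m + (i : ℕ), b i) := fun j k hjk => by
    have := (Prod.mk.inj hjk).1
    exact Nat.eq_of_mul_eq_mul_right i.pos (by omega)
  simp_rw [sampleMean_sub hn]
  exact integral_abs_sum_div_le (hind.precomp hinj) (fun j => hasSubgaussianMGF_reward h _) hn

lemma integrable_sampleMean_sub
    (h : ∀ t a, HasSubgaussianMGF (fun r => r - μ a) 1 (D t a)) (hn : 0 < n) (i : Fin m) :
    Integrable (fun x => sampleMean n b x i - μ (b i)) (rewardLaw D) := by
  simp_rw [sampleMean_sub hn]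
  exact (integrable_finsetSum _ fun j _ =>
    (hasSubgaussianMGF_reward h (j * m + i, b i)).integrable).div_const _

/-- Union bound over the arms. For one arm, the triangle inequality through the true mean bounds the
expected gap of the two sample means by `2 / √n + 2 / √n`. -/
lemma measure_roundedMean_ne_le
    (h : ∀ t a, HasSubgaussianMGF (fun r => r - μ a) 1 (D t a)) (hn : 0 < n) (hw : 0 < w) :
    (uniformUnit.prod ((rewardLaw D).prod (rewardLaw D))).real
      {p | roundedMean n b w p.1 p.2.1 = roundedMean n b w p.1 p.2.2}ᶜ ≤ m * (4 / (√n * w)) := by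
  set Q := (rewardLaw D).prod (rewardLaw D)
  have hone : ∀ i : Fin m, (uniformUnit.prod Q).real
      {p | ⌊sampleMean n b p.2.1 i / w + p.1⌋ ≠ ⌊sampleMean n b p.2.2 i / w + p.1⌋} ≤
        4 / (√n * w) := by
    intro i
    refine ENNReal.toReal_le_of_le_ofReal (by positivity) ?_
    refine (prod_uniformUnit_floor_ne_le (P := Q)
      (X := fun q => sampleMean n b q.1 i / w) (Y := fun q => sampleMean n b q.2 i / w)
      (((measurable_sampleMean i).comp measurable_fst).div_const w)
      (((measurable_sampleMean i).comp measurable_snd).div_const w)).trans ?_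
    have h1 : Integrable (fun q : (ℕ × α → ℝ) × (ℕ × α → ℝ) =>
        |sampleMean n b q.1 i - μ (b i)|) Q :=
      (integrable_sampleMean_sub h hn i).abs.comp_fst _
    have h2 : Integrable (fun q : (ℕ × α → ℝ) × (ℕ × α → ℝ) =>
        |sampleMean n b q.2 i - μ (b i)|) Q :=
      (integrable_sampleMean_sub h hn i).abs.comp_snd _
    calc ∫⁻ q, ENNReal.ofReal |sampleMean n b q.1 i / w - sampleMean n b q.2 i / w| ∂Q
        ≤ ∫⁻ q, ENNReal.ofReal
            ((|sampleMean n b q.1 i - μ (b i)| + |sampleMean n b q.2 i - μ (b i)|) / w) ∂Q := by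
          refine lintegral_mono fun q => ENNReal.ofReal_le_ofReal ?_
          rw [← sub_div, abs_div, abs_of_pos hw]
          gcongr
          rw [abs_sub_comm (sampleMean n b q.2 i)]
          exact abs_sub_le _ _ _
      _ = ENNReal.ofReal (∫ q,
            (|sampleMean n b q.1 i - μ (b i)| + |sampleMean n b q.2 i - μ (b i)|) / w ∂Q) :=
          (ofReal_integral_eq_lintegral_ofReal ((h1.add h2).div_const w)
            (ae_of_all _ fun q => div_nonneg (add_nonneg (abs_nonneg _) (abs_nonneg _)) hw.le)).symm
      _ ≤ ENNReal.ofReal (4 / (√n * w)) := by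
          refine ENNReal.ofReal_le_ofReal ?_
          rw [integral_div, integral_add h1 h2]
          have e1 := integral_fun_fst (μ := rewardLaw D) (ν := rewardLaw D)
            fun x => |sampleMean n b x i - μ (b i)|
          have e2 := integral_fun_snd (μ := rewardLaw D) (ν := rewardLaw D)
            fun x => |sampleMean n b x i - μ (b i)|
          have := integral_abs_sampleMean_sub_le (b := b) h hn i
          simp only [probReal_univ, one_smul] at e1 e2
          rw [e1, e2, ← div_div]
          gcongr
          linarith [show (4 : ℝ) / √n = 2 / √n + 2 / √n by ring]
  calc _ ≤ (uniformUnit.prod Q).real (⋃ i : Fin m,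
        {p | ⌊sampleMean n b p.2.1 i / w + p.1⌋ ≠ ⌊sampleMean n b p.2.2 i / w + p.1⌋}) := by
        refine measureReal_mono fun p hp => ?_
        obtain ⟨i, hi⟩ := Function.ne_iff.1 hp
        exact Set.mem_iUnion.2 ⟨i, hi⟩
    _ ≤ ∑ i : Fin m, 4 / (√n * w) :=
        (measureReal_iUnion_fintype_le _).trans (Finset.sum_le_sum fun i _ => hone i)
    _ = m * (4 / (√n * w)) := by simp

end Estimation

/-! ### The policy and its reproducibility. -/

variable {α : Type} [MeasurableSpace α]

lemma history_apply (π : BanditPolicy α) (ξ : π.Seed) (x : ℕ × α → ℝ) {s t : ℕ} (hs : s < t) :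
    π.history ξ x t ⟨s, hs⟩ = (π.action ξ x s, x (s, π.action ξ x s)) := by
  induction t with
  | zero => omega
  | succ t ih =>
    rcases Nat.lt_succ_iff_lt_or_eq.1 hs with h | rfl
    · rw [← ih h]
      exact Fin.snoc_castSucc (α := fun _ => α × ℝ) (i := ⟨s, h⟩) _ _
    · exact Fin.snoc_last (α := fun _ => α × ℝ) _ _

/-- The reward of round `s` recorded in a history, and `0` if that round is not over. -/
def pastReward {t : ℕ} (h : Fin t → α × ℝ) (s : ℕ) : ℝ :=
  if hs : s < t then (h ⟨s, hs⟩).2 else 0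

lemma measurable_pastReward (t s : ℕ) :
    Measurable fun h : Fin t → α × ℝ => pastReward h s := by
  unfold pastReward
  split_ifs
  · fun_prop
  · exact measurable_const

/-- Explore then commit with replicable rounding: pull the arms `b 0, …, b (m - 1)` in turn, `n`
times each, round their mean rewards to a randomly shifted grid of width `w`, and play from then on
the arm that `g` assigns to the vector of rounded means. -/
noncomputable abbrev exploreThenCommit {m : ℕ} (n : ℕ) (b : Fin m → α) (w : ℝ)
    (g : (Fin m → ℤ) → α) : BanditPolicy α where
  Seed := ℝ
  seedLaw := uniformUnit
  act t ξ h :=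
    if ht : t < m * n then b ⟨t % m, Nat.mod_lt _ (Nat.pos_of_ne_zero (by rintro rfl; simp at ht))⟩
    else g fun i => ⌊(∑ j ∈ Finset.range n, pastReward h (j * m + i)) / n / w + ξ⌋
  measurable_act t := by
    split_ifs
    · exact measurable_const
    · refine (Measurable.of_discrete (f := g)).comp (measurable_pi_lambda _ fun i => ?_)
      have (j : ℕ) :
          Measurable fun p : ℝ × (Fin t → α × ℝ) => pastReward p.2 (j * m + i) :=
        (measurable_pastReward t _).comp measurable_snd
      refine Int.measurable_floor.comp (Measurable.add ?_ measurable_fst)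
      exact ((Finset.measurable_sum _ fun j _ => this j).div_const _).div_const _

variable {m n : ℕ} {b : Fin m → α} {w : ℝ} {g : (Fin m → ℤ) → α}

lemma exploreThenCommit_action_of_lt (ξ : ℝ) (x : ℕ × α → ℝ) {t : ℕ} (hm : 0 < m)
    (ht : t < m * n) :
    (exploreThenCommit n b w g).action ξ x t = b ⟨t % m, Nat.mod_lt _ hm⟩ :=
  dif_pos ht

/-- Round `j * m + i` pulls `b i`, so the recorded rewards are exactly those averaged in
`sampleMean`. -/
lemma exploreThenCommit_action_of_ge (ξ : ℝ) (x : ℕ × α → ℝ) {t : ℕ} (ht : m * n ≤ t) :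
    (exploreThenCommit n b w g).action ξ x t = g (roundedMean n b w ξ x) := by
  refine (dif_neg ht.not_gt).trans (congrArg g (funext fun i => ?_))
  have hm : 0 < m := i.pos
  rw [roundedMean, sampleMean]
  congr 4
  refine Finset.sum_congr rfl fun j hj => ?_
  have hlt : j * m + i < m * n := by
    have := Finset.mem_range.1 hj
    nlinarith [i.2]
  rw [pastReward, dif_pos (hlt.trans_le ht), history_apply,
    exploreThenCommit_action_of_lt _ _ hm hlt]
  have : (⟨(j * m + i) % m, Nat.mod_lt _ hm⟩ : Fin m) = i := by
    ext
    simp [Nat.mod_eq_of_lt i.2]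
  simp only [this]

lemma measurable_exploreThenCommit_action (t : ℕ) :
    Measurable fun p : ℝ × (ℕ × α → ℝ) => (exploreThenCommit n b w g).action p.1 p.2 t := by
  rcases lt_or_ge t (m * n) with ht | ht
  · have hm : 0 < m := Nat.pos_of_ne_zero (by rintro rfl; simp at ht)
    simp_rw [exploreThenCommit_action_of_lt _ _ hm ht]
    exact measurable_const
  · simp_rw [exploreThenCommit_action_of_ge _ _ ht]
    exact (Measurable.of_discrete (f := g)).comp measurable_roundedMean

/-- Exploration is deterministic and the committed arm is a function of the rounded means, so equal
rounded means force equal arm sequences. -/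
lemma exploreThenCommit_reproducible_bound {D : ℕ → α → Measure ℝ}
    [∀ t a, IsProbabilityMeasure (D t a)] {μ : α → ℝ}
    (h : ∀ t a, HasSubgaussianMGF (fun r => r - μ a) 1 (D t a)) (hn : 0 < n) (hw : 0 < w)
    (T : ℕ) :
    1 - m * (4 / (√n * w)) ≤ (uniformUnit.prod ((rewardLaw D).prod (rewardLaw D))).real
      {p | ∀ t < T, (exploreThenCommit n b w g).action p.1 p.2.1 t =
        (exploreThenCommit n b w g).action p.1 p.2.2 t} := by
  have h1 := measure_roundedMean_ne_le (b := b) h hn hw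
  have hm := measurableSet_roundedMean_eq (n := n) (b := b) (w := w)
  have h2 := probReal_add_probReal_compl (μ := uniformUnit.prod ((rewardLaw D).prod (rewardLaw D)))
    hm
  refine (by linarith : _ ≤ _).trans (measureReal_mono
    (s₁ := {p : ℝ × (ℕ × α → ℝ) × (ℕ × α → ℝ) |
      roundedMean n b w p.1 p.2.1 = roundedMean n b w p.1 p.2.2}) fun p hp t _ => ?_)
  rcases lt_or_ge t (m * n) with ht | ht
  · have hm : 0 < m := Nat.pos_of_ne_zero (by rintro rfl; simp at ht)
    rw [exploreThenCommit_action_of_lt _ _ hm ht, exploreThenCommit_action_of_lt _ _ hm ht]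
  · rw [exploreThenCommit_action_of_ge _ _ ht, exploreThenCommit_action_of_ge _ _ ht]
    exact congrArg g hp

end BanditPolicy

/-! ### Regret of the policy. -/

namespace BanditPolicy

variable {α : Type} [MeasurableSpace α] {m n : ℕ} {b : Fin m → α} {w : ℝ}
  {g : (Fin m → ℤ) → α}

variable {D : ℕ → α → Measure ℝ} [∀ t a, IsProbabilityMeasure (D t a)] {μ : α → ℝ}

lemma integrable_comp_action (hμ : Measurable μ) (hμ1 : ∀ a, |μ a| ≤ 1) (t : ℕ) :
    Integrable (fun p : ℝ × (ℕ × α → ℝ) => μ ((exploreThenCommit n b w g).action p.1 p.2 t))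
      (uniformUnit.prod (rewardLaw D)) :=
  Integrable.of_bound (hμ.comp (measurable_exploreThenCommit_action t)).aestronglyMeasurable 1
    (ae_of_all _ fun _ => hμ1 _)

/-- After the exploration, the expected regret of a round is small when `g` is greedy. -/
lemma exploreThenCommit_instantRegret_le (hμ : Measurable μ) (hμ1 : ∀ a, |μ a| ≤ 1)
    (h : ∀ t a, HasSubgaussianMGF (fun r => r - μ a) 1 (D t a)) (hn : 0 < n) (hw : 0 < w)
    (hg : ∀ z a, μ a - μ (g z) ≤ 2 * ∑ i, |w * z i - μ (b i)|) (a : α) {t : ℕ}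
    (ht : m * n ≤ t) :
    μ a - ∫ p, μ ((exploreThenCommit n b w g).action p.1 p.2 t) ∂(uniformUnit.prod (rewardLaw D)) ≤
      2 * m * (w + 2 / √n) := by
  have hint : ∀ i : Fin m, Integrable (fun p : ℝ × (ℕ × α → ℝ) =>
      w + |sampleMean n b p.2 i - μ (b i)|) (uniformUnit.prod (rewardLaw D)) := fun i =>
    (integrable_const w).add ((integrable_sampleMean_sub h hn i).abs.comp_snd _)
  have hI := integrable_comp_action (n := n) (b := b) (w := w) (g := g) (D := D) hμ hμ1 t
  have hξ : ∀ᵐ p ∂(uniformUnit.prod (rewardLaw D)), p.1 ∈ Set.Ioc (0 : ℝ) 1 :=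
    Measure.quasiMeasurePreserving_fst.ae (ae_restrict_mem measurableSet_Ioc)
  calc μ a - ∫ p, μ ((exploreThenCommit n b w g).action p.1 p.2 t)
          ∂(uniformUnit.prod (rewardLaw D))
      = ∫ p, (μ a - μ ((exploreThenCommit n b w g).action p.1 p.2 t))
          ∂(uniformUnit.prod (rewardLaw D)) := by
        rw [integral_sub (integrable_const _) hI]
        simp
    _ ≤ ∫ p, 2 * ∑ i, (w + |sampleMean n b p.2 i - μ (b i)|)
          ∂(uniformUnit.prod (rewardLaw D)) := by
        refine integral_mono_ae ((integrable_const _).sub hI)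
          ((integrable_finsetSum _ fun i _ => hint i).const_mul 2) ?_
        filter_upwards [hξ] with p hp
        rw [exploreThenCommit_action_of_ge _ _ ht]
        refine (hg _ a).trans ?_
        gcongr with i
        exact abs_mul_roundedMean_sub_le hw hp _ i _
    _ = 2 * ∑ i : Fin m, (w + ∫ x, |sampleMean n b x i - μ (b i)| ∂(rewardLaw D)) := by
        rw [integral_const_mul, integral_finsetSum _ fun i _ => hint i]
        congr 1
        refine Finset.sum_congr rfl fun i _ => ?_
        have e2 := integral_fun_snd (μ := uniformUnit) (ν := rewardLaw D)
          fun x => |sampleMean n b x i - μ (b i)|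
        rw [integral_add (integrable_const w) ((integrable_sampleMean_sub h hn i).abs.comp_snd _),
          e2]
        simp
    _ ≤ 2 * ∑ _i : Fin m, (w + 2 / √n) := by
        gcongr with i
        exact integral_abs_sampleMean_sub_le h hn i
    _ = 2 * m * (w + 2 / √n) := by simp; ring

/-- Here `s` stands for the supremum over the whole action set and `ε` for the net error. The
trivial bound `2 * T` is kept for the regime where `d` is large compared with `T`. -/
lemma exploreThenCommit_regret_le (hμ : Measurable μ) (hμ1 : ∀ a, |μ a| ≤ 1)
    (h : ∀ t a, HasSubgaussianMGF (fun r => r - μ a) 1 (D t a)) (hn : 0 < n) (hw : 0 < w)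
    (hg : ∀ z a, μ a - μ (g z) ≤ 2 * ∑ i, |w * z i - μ (b i)|) {s ε : ℝ} (hs : s ≤ 1)
    (hε : 0 ≤ ε) (hsε : ∃ a, s ≤ μ a + ε) (T : ℕ) :
    T * s - ∫ p, ∑ t ∈ Finset.range T, μ ((exploreThenCommit n b w g).action p.1 p.2 t)
      ∂(uniformUnit.prod (rewardLaw D)) ≤
        min (2 * T : ℝ) (T * ε + 2 * (m * n) + T * (2 * m * (w + 2 / √n))) := by
  have hI := integrable_comp_action (n := n) (b := b) (w := w) (g := g) (D := D) hμ hμ1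
  obtain ⟨a, ha⟩ := hsε
  have hK : 0 ≤ 2 * m * (w + 2 / √n) := by positivity
  set J : ℕ → ℝ := fun t => ∫ p, μ ((exploreThenCommit n b w g).action p.1 p.2 t)
    ∂(uniformUnit.prod (rewardLaw D)) with hJ
  have htriv : ∀ t, s - J t ≤ 2 := fun t => by
    have : -1 ≤ J t := by
      have := integral_mono (μ := uniformUnit.prod (rewardLaw D)) (integrable_const (-1 : ℝ))
        (hI t) fun p => (abs_le.1 (hμ1 _)).1
      simpa using this
    linarith
  have hsum : T * s - ∫ p, ∑ t ∈ Finset.range T,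
      μ ((exploreThenCommit n b w g).action p.1 p.2 t) ∂(uniformUnit.prod (rewardLaw D)) =
      ∑ t ∈ Finset.range T, (s - J t) := by
    rw [integral_finsetSum _ fun t _ => hI t, Finset.sum_sub_distrib]
    simp [hJ]
  rw [hsum]
  refine le_min ?_ ?_
  · refine (Finset.sum_le_sum fun t _ => htriv t).trans (le_of_eq ?_)
    simp [mul_comm]
  -- Every round is charged the committed cost, and an exploration round `2` more.
  · have hround : ∀ t, s - J t ≤
        (ε + 2 * m * (w + 2 / √n)) + if t < m * n then 2 else 0 := fun t => by
      split_ifs with ht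
      · linarith [htriv t]
      · have := exploreThenCommit_instantRegret_le (D := D) hμ hμ1 h hn hw hg a (not_lt.1 ht)
        simp only [hJ]
        linarith
    refine (Finset.sum_le_sum fun t _ => hround t).trans ?_
    rw [Finset.sum_add_distrib, ← Finset.sum_filter]
    have hcard : ((Finset.range T).filter (· < m * n)).card ≤ m * n := by
      refine (Finset.card_le_card (t := Finset.range (m * n)) fun t ht => ?_).trans (by simp)
      simpa using (Finset.mem_filter.1 ht).2
    have hcard' : (((Finset.range T).filter (· < m * n)).card : ℝ) ≤ m * n := by
      exact_mod_cast hcard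
    simp only [Finset.sum_const, Finset.card_range, nsmul_eq_mul]
    linarith

end BanditPolicy

/-! ### Greedy choice and the arithmetic of the rate. -/

/-- For rewards that are combinations with coefficients in `[-1, 1]` of the rewards of `m` arms,
the greedy choice for estimates of these `m` rewards loses at most twice the total error. -/
lemma exists_greedy {α : Type} [Finite α] [Nonempty α] {m : ℕ} (b : Fin m → α)
    (c : α → Fin m → ℝ) (hc : ∀ a i, |c a i| ≤ 1) (w : ℝ) :
    ∃ g : (Fin m → ℤ) → α, ∀ μ : α → ℝ, (∀ a, μ a = ∑ i, c a i * μ (b i)) →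
      ∀ z a, μ a - μ (g z) ≤ 2 * ∑ i, |w * z i - μ (b i)| := by
  choose g hg using fun z : Fin m → ℤ => Finite.exists_max fun a : α => ∑ i, c a i * (w * z i)
  refine ⟨g, fun μ hμ z a => ?_⟩
  have herr : ∀ a, |∑ i, c a i * (w * z i) - μ a| ≤ ∑ i, |w * z i - μ (b i)| := fun a => by
    rw [hμ a, ← Finset.sum_sub_distrib]
    refine (Finset.abs_sum_le_sum_abs _ _).trans (Finset.sum_le_sum fun i _ => ?_)
    rw [← mul_sub, abs_mul]
    exact mul_le_of_le_one_left (abs_nonneg _) (hc a i)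
  linarith [hg z a, abs_le.1 (herr a), abs_le.1 (herr (g z))]

/-- `x ^ (4 * d + 2)` plays the role of `T`. If `x ≤ √d`, the trivial bound is enough; if `√d ≤ x`,
powers of `√d` are absorbed into powers of `x`. -/
lemma regret_rate_le {d n : ℕ} (hd : 1 ≤ d) {x ρ R : ℝ} (hx : 1 ≤ x) (hρ : 0 < ρ) (hρ1 : ρ ≤ 1)
    (hn : x ^ (4 * d) ≤ n) (hn' : n ≤ 2 * x ^ (4 * d)) (h1 : R ≤ 2 * x ^ (4 * d + 2))
    (h2 : R ≤ x ^ (4 * d + 2) * (1 / x) + 2 * (d * n) +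
      x ^ (4 * d + 2) * (2 * d * (4 * d / (ρ * √n) + 2 / √n))) :
    R ≤ 17 * (x ^ (4 * d + 1) / ρ ^ 2) * √d := by
  have hx0 : 0 < x := by linarith
  have hd0 : (0 : ℝ) ≤ d := Nat.cast_nonneg d
  obtain ⟨r, hr⟩ : ∃ r, r = √(d : ℝ) := ⟨_, rfl⟩
  have hrd : (d : ℝ) = r ^ 2 := by rw [hr, Real.sq_sqrt hd0]
  have hr1 : 1 ≤ r := by rw [hr]; exact Real.one_le_sqrt.2 (by exact_mod_cast hd)
  rw [← hr]
  obtain ⟨y, hy⟩ : ∃ y, y = x ^ (4 * d + 1) := ⟨_, rfl⟩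
  have hy0 : 0 < y := hy ▸ by positivity
  have hT : x ^ (4 * d + 2) = y * x := by rw [hy]; ring
  have hyn : x ^ (4 * d) = y / x := by rw [hy]; field_simp; ring
  rw [hT] at h1 h2
  rw [hyn] at hn hn'
  rw [← hy]
  have hρ2 : 1 ≤ 1 / ρ := by rw [le_div_iff₀ hρ]; linarith
  -- The argument yields `1 / ρ`, which is weakened to `1 / ρ ^ 2`.
  have hfin : R ≤ 17 * (y * r) * (1 / ρ) → R ≤ 17 * (y / ρ ^ 2) * r := fun h => by
    refine h.trans ?_
    have : 17 * (y / ρ ^ 2) * r = 17 * (y * r) * (1 / ρ) * (1 / ρ) := by field_simp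
    rw [this]
    exact le_mul_of_one_le_right (by positivity) hρ2
  apply hfin
  rcases le_total x r with hxr | hxr
  · have e1 : 2 * (y * x) ≤ 2 * (y * r) := by gcongr
    have e2 : 2 * (y * r) ≤ 17 * (y * r) * (1 / ρ) := by
      have : 0 < y * r := by positivity
      nlinarith
    linarith
  · have hsq : x ^ (2 * d) ≤ √n := by
      refine Real.le_sqrt_of_sq_le ?_
      rw [← pow_mul, show 2 * d * 2 = 4 * d by ring, hyn]
      exact hn
    have hs : 1 / √(n : ℝ) ≤ 1 / x ^ (2 * d) := by gcongr
    -- `r ^ 3 ≤ x ^ 3` needs `4 ≤ 2 * d`; for `d = 1` one has `r = 1` instead.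
    have hr4 : r ^ 4 * x ≤ r * x ^ (2 * d) := by
      obtain rfl | hd2 : d = 1 ∨ 2 ≤ d := by omega
      · have : r = 1 := by rw [hr]; simp
        rw [this]; norm_num; nlinarith
      · obtain ⟨k, rfl⟩ := Nat.exists_eq_add_of_le hd2
        calc r ^ 4 * x = r * r ^ 3 * x := by ring
          _ ≤ r * x ^ 3 * x := by gcongr
          _ = r * x ^ 4 := by ring
          _ ≤ r * x ^ (2 * (2 + k)) := by
            exact mul_le_mul_of_nonneg_left (pow_le_pow_right₀ hx (by omega)) (by linarith)
    have hkey : x * (d * d) * (1 / √n) ≤ r := by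
      calc x * (d * d) * (1 / √n) ≤ x * (d * d) * (1 / x ^ (2 * d)) := by gcongr
        _ = r ^ 4 * x / x ^ (2 * d) := by rw [hrd]; ring
        _ ≤ r := by rw [div_le_iff₀ (by positivity)]; exact hr4
    have hd1 : (1 : ℝ) ≤ d := by exact_mod_cast hd
    have hkey' : x * d * (1 / √n) ≤ r := by
      refine le_trans ?_ hkey
      gcongr
      nlinarith
    have hdn : d * (n : ℝ) ≤ 2 * (y * r) := by
      calc d * (n : ℝ) ≤ r ^ 2 * (2 * (y / x)) := by rw [hrd]; gcongr
        _ = 2 * (y * r) * (r / x) := by ring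
        _ ≤ 2 * (y * r) := mul_le_of_le_one_right (by positivity) ((div_le_one hx0).2 hxr)
    have e : y * x * (1 / x) + 2 * (d * n) + y * x * (2 * d * (4 * d / (ρ * √n) + 2 / √n)) =
        y + 2 * (d * n) + 8 * (y * (x * (d * d) * (1 / √n))) * (1 / ρ) +
          4 * (y * (x * d * (1 / √n))) := by
      field_simp
      ring
    rw [e] at h2
    have hA : y * (x * (d * d) * (1 / √n)) ≤ y * r := by gcongr
    have hB : y * (x * d * (1 / √n)) ≤ y * r := by gcongr
    have hC : y ≤ y * r := le_mul_of_one_le_right hy0.le hr1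
    have hE : 8 * (y * (x * (d * d) * (1 / √n))) * (1 / ρ) ≤ 8 * (y * r) * (1 / ρ) := by gcongr
    have hF : y * r ≤ y * r * (1 / ρ) := le_mul_of_one_le_right (by positivity) hρ2
    -- The four terms contribute `1 + 4 + 8 + 4 = 17`.
    linarith

lemma one_le_dim_of_infinite {d : ℕ} {A : Set (EuclideanSpace ℝ (Fin d))} (hA : A.Infinite) :
    1 ≤ d := by
  by_contra h
  obtain rfl : d = 0 := by omega
  exact hA (Set.subsingleton_of_subsingleton.finite)

/-! ### Choice of parameters and conclusion. -/

theorem mainTheorem7 :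
    ∃ C : ℝ, 0 < C ∧
      ∀ (d T : ℕ) (ρ : ℝ) (A : Set (EuclideanSpace ℝ (Fin d))),
        2 ≤ T → 0 < ρ → ρ ≤ 1 → A.Infinite → (∀ a ∈ A, ‖a‖ ≤ 1) →
        ∃ N : Finset (EuclideanSpace ℝ (Fin d)),
          (∀ a ∈ N, a ∈ A) ∧
          (∀ a ∈ A, ∃ a' ∈ N, ‖a - a'‖ ≤ 1 / (T : ℝ) ^ (1 / (4 * d + 2) : ℝ)) ∧
          ∃ π : BanditPolicy N,
            π.IsReproducible T ρ
              (fun D => ∃ θ : EuclideanSpace ℝ (Fin d), ‖θ‖ ≤ 1 ∧ IsLinearEnvironment N θ D) ∧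
            ∀ θ : EuclideanSpace ℝ (Fin d), ‖θ‖ ≤ 1 →
              ∀ (D : ℕ → N → Measure ℝ) [∀ t a, IsProbabilityMeasure (D t a)],
                IsLinearEnvironment N θ D →
                linearExpectedRegret A θ T π D ≤
                  C * ((T : ℝ) ^ ((4 * d + 1) / (4 * d + 2) : ℝ) / ρ ^ 2) *
                    Real.sqrt (d * Real.log T) := by
  refine ⟨34, by norm_num, fun d T ρ A hT hρ hρ1 hAinf hA => ?_⟩
  have hd := one_le_dim_of_infinite hAinf
  have hT0 : (0 : ℝ) < T := by exact_mod_cast (by omega : 0 < T)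
  have hT1 : (1 : ℝ) ≤ T := by exact_mod_cast (by omega : 1 ≤ T)
  set x : ℝ := (T : ℝ) ^ (1 / (4 * d + 2) : ℝ) with hxdef
  have hx : 1 ≤ x := Real.one_le_rpow hT1 (by positivity)
  have hx0 : 0 < x := by linarith
  have hxpow (k : ℕ) : x ^ k = (T : ℝ) ^ (k / (4 * d + 2) : ℝ) := by
    rw [hxdef, ← Real.rpow_natCast, ← Real.rpow_mul hT0.le]
    congr 1
    ring
  have hxT : x ^ (4 * d + 2) = T := by
    rw [hxpow]
    push_cast
    rw [div_self (by positivity), Real.rpow_one]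
  have hxT' : (T : ℝ) ^ ((4 * d + 1) / (4 * d + 2) : ℝ) = x ^ (4 * d + 1) := by
    rw [hxpow]
    push_cast
    rfl
  rw [hxT']
  obtain ⟨N, hNA, hnet⟩ := exists_finset_net hA (one_div_pos.2 hx0)
  refine ⟨N, hNA, hnet, ?_⟩
  obtain ⟨a₀, ha₀⟩ := hAinf.nonempty
  obtain ⟨a₁, ha₁, -⟩ := hnet a₀ ha₀
  have : Nonempty N := ⟨⟨a₁, ha₁⟩⟩
  have : Nonempty A := ⟨⟨a₀, ha₀⟩⟩
  obtain ⟨m, b, c, hmd, hc, hbc⟩ := exists_barycentric_spanner N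
  rw [finrank_euclideanSpace_fin] at hmd
  have hmd' : (m : ℝ) ≤ d := by exact_mod_cast hmd
  obtain ⟨n, hndef⟩ : ∃ n, n = ⌈x ^ (4 * d)⌉₊ := ⟨_, rfl⟩
  have hxn1 : 1 ≤ x ^ (4 * d) := one_le_pow₀ hx
  have hn : x ^ (4 * d) ≤ n := hndef ▸ Nat.le_ceil _
  have hn' : n ≤ 2 * x ^ (4 * d) := by
    have := Nat.ceil_lt_add_one (zero_le_one.trans hxn1)
    rw [← hndef] at this
    linarith
  have hn0' : (0 : ℝ) < n := by linarith
  have hn0 : 0 < n := by exact_mod_cast hn0'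
  have hd1 : (1 : ℝ) ≤ d := by exact_mod_cast hd
  -- This width solves `d * (4 / (√n * w)) = ρ`.
  obtain ⟨w, hwdef⟩ : ∃ w : ℝ, w = 4 * d / (ρ * √n) := ⟨_, rfl⟩
  have hw : 0 < w := hwdef ▸ by positivity
  obtain ⟨g, hg⟩ := exists_greedy b c hc w
  have hlin (θ : EuclideanSpace ℝ (Fin d)) (a : N) :
      ⟪θ, (a : EuclideanSpace ℝ (Fin d))⟫ =
        ∑ i, c a i * ⟪θ, (b i : EuclideanSpace ℝ (Fin d))⟫ := by
    conv_lhs => rw [hbc a, inner_sum]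
    simp_rw [real_inner_smul_right]
  have hbound (θ : EuclideanSpace ℝ (Fin d)) (hθ : ‖θ‖ ≤ 1) (a : EuclideanSpace ℝ (Fin d))
      (ha : ‖a‖ ≤ 1) : |⟪θ, a⟫| ≤ 1 :=
    (abs_real_inner_le_norm θ a).trans (mul_le_one₀ hθ (norm_nonneg a) ha)
  refine ⟨BanditPolicy.exploreThenCommit n b w g, ?_, ?_⟩
  · rintro D _ ⟨θ, -, hD⟩
    refine le_trans ?_ (BanditPolicy.exploreThenCommit_reproducible_bound
      (μ := fun a : N => ⟪θ, (a : EuclideanSpace ℝ (Fin d))⟫)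
      (fun t a => (hD t a).2.2) hn0 hw T)
    have : (m : ℝ) * (4 / (√n * w)) ≤ ρ :=
      calc (m : ℝ) * (4 / (√n * w)) ≤ d * (4 / (√n * w)) := by gcongr
        _ = ρ := by rw [hwdef]; field_simp
    linarith
  · intro θ hθ D _ hD
    have hsup : ⨆ a : A, ⟪θ, (a : EuclideanSpace ℝ (Fin d))⟫ ≤ 1 :=
      ciSup_le fun a => (abs_le.1 (hbound θ hθ a (hA a a.2))).2
    obtain ⟨a', ha'⟩ := Finite.exists_max fun a : N => ⟪θ, (a : EuclideanSpace ℝ (Fin d))⟫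
    -- By Cauchy–Schwarz and `‖θ‖ ≤ 1`, passing to the net costs at most its mesh `1 / x`.
    have hsup' : ⨆ a : A, ⟪θ, (a : EuclideanSpace ℝ (Fin d))⟫ ≤
        ⟪θ, (a' : EuclideanSpace ℝ (Fin d))⟫ + 1 / x := ciSup_le fun a => by
      obtain ⟨a'', hN, hdist⟩ := hnet a a.2
      have h1 : ⟪θ, (a : EuclideanSpace ℝ (Fin d)) - a''⟫ ≤ 1 / x :=
        (real_inner_le_norm _ _).trans
          ((mul_le_of_le_one_left (norm_nonneg _) hθ).trans hdist)
      rw [inner_sub_right] at h1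
      linarith [ha' ⟨a'', hN⟩]
    have hreg := BanditPolicy.exploreThenCommit_regret_le (D := D)
      (μ := fun a : N => ⟪θ, (a : EuclideanSpace ℝ (Fin d))⟫) (Measurable.of_discrete)
      (fun a => hbound θ hθ a (hA a (hNA a a.2))) (fun t a => (hD t a).2.2) hn0 hw
      (hg _ (hlin θ)) hsup (one_div_pos.2 hx0).le ⟨a', hsup'⟩ T
    obtain ⟨h1, h2⟩ := le_min_iff.1 hreg
    have hrate := regret_rate_le
      (R := linearExpectedRegret A θ T (BanditPolicy.exploreThenCommit n b w g) D) hd hx hρ hρ1 hn hn' (by rw [hxT]; exact h1) (by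
      rw [hxT]
      refine h2.trans ?_
      rw [hwdef]
      gcongr)
    -- The logarithm is only used through `log T ≥ log 2 > 1 / 4`; this doubles `17` to `34`.
    have hlog : 1 / 2 * √(d : ℝ) ≤ √(d * Real.log T) := by
      rw [Real.sqrt_mul (Nat.cast_nonneg d), mul_comm]
      gcongr
      refine Real.le_sqrt_of_sq_le ?_
      have : Real.log 2 ≤ Real.log T := Real.log_le_log (by norm_num) (by exact_mod_cast hT)
      linarith [Real.log_two_gt_d9]
    refine hrate.trans ?_
    calc 17 * (x ^ (4 * d + 1) / ρ ^ 2) * √(d : ℝ)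
        = 34 * (x ^ (4 * d + 1) / ρ ^ 2) * (1 / 2 * √(d : ℝ)) := by ring
      _ ≤ 34 * (x ^ (4 * d + 1) / ρ ^ 2) * √(d * Real.log T) := by gcongr
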